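/- Let $E$ be a separable reflexive real Banach space (for example, a separable UMD space), let $T>0$ and $1<p<\infty$, and let $(\Omega,\mathscr F,(\mathscr F_t)_{t\in[0,T]},\mathbb P)$ be a filtered probability space with $\mathscr F_T=\mathscr F$. Write $\mathscr K_{cwcmpt}(E)$ for the class of nonempty convex weakly compact subsets of $E$. For $A,B\in\mathscr K_{cwcmpt}(E)$ the Hukuhara difference $A\ominus B$ is the (unique, if it exists) nonempty closed convex set $C\subseteq E$ with $B+C=A$. For set-valued maps $\Phi^{(1)},\Phi^{(2)}$ with values in $\mathscr K_{cwcmpt}(E)$, the difference $\Phi^{(1)}\ominus\Phi^{(2)}$ is said to exist if $\Phi^{(1)}(\omega)\ominus\Phi^{(2)}(\omega)$ exists for every $\omega\in\Omega$, and it is then defined pointwise. A set-valued map $H$ on $\Omega$ is measurable with respect to a $\sigma$-algebra $\mathscr A$ if $\{\omega: H(\omega)\cap O\neq\emptyset\}\in\mathscr A$ for every open $O\subseteq E$. It is $p$-integrably bounded if there is a real function $v\in L^p(\Omega)$ with $\sup_{x\in H(\omega)}\|x\|\le v(\omega)$ for almost every $\omega$. Let $S^p_{\mathscr A}(H)$ be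 the set of all $g\in L^p(\Omega,\mathscr A;E)$ with $g(\omega)\in H(\omega)$ almost surely. For a $\mathscr F$-measurable $p$-integrably bounded map $G$ with nonempty closed values and a sub-$\sigma$-algebra $\mathscr A'$ of $\mathscr F$, the conditional expectation $\mathbb E^{\mathscr A'}(G)$ is the (almost surely unique) $\mathscr A'$-measurable map with nonempty closed values such that $$S^p_{\mathscr A'}\big(\mathbb E^{\mathscr A'}(G)\big)=\overline{\{\mathbb E^{\mathscr A'}(g): g\in S^p_{\mathscr F}(G)\}},$$ the closure being taken in the norm of $L^p$. Let $\Phi^{(1)},\Phi^{(2)}:\Omega\to\mathscr K_{cwcmpt}(E)$ be $\mathscr F_T$-measurable set-valued maps whose Hukuhara difference $\Phi^{(1)}\ominus\Phi^{(2)}$ exists. Then $\Phi^{(1)}\ominus\Phi^{(2)}$ is $\mathscr F_T$-measurable. If moreover $\Phi^{(1)}$ and $\Phi^{(2)}$ are $p$-integrably bounded, then $\Phi^{(1)}\ominus\Phi^{(2)}$ is $p$-integrably bounded, and for every $t\in[0,T]$ the conditional expectations below exist and, almost surely, their values satisfy $\mathbb E^{\mathscr F_t}(\Phi^{(1)}),\mathbb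 E^{\mathscr F_t}(\Phi^{(2)})\in\mathscr K_{cwcmpt}(E)$, the Hukuhara difference on the right-hand side exists, and $$\mathbb E^{\mathscr F_t}\big(\Phi^{(1)}\ominus\Phi^{(2)}\big)=\mathbb E^{\mathscr F_t}\big(\Phi^{(1)}\big)\ominus\mathbb E^{\mathscr F_t}\big(\Phi^{(2)}\big).$$ -/

import Mathlib

open MeasureTheory Set
open scoped ENNReal Pointwise

/-- The class of nonempty convex weakly compact subsets of `E`. -/
def convexWeaklyCompacts (E : Type*) [NormedAddCommGroup E] [NormedSpace ℝ E] : Set (Set E) :=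
  {A | A.Nonempty ∧ Convex ℝ A ∧ IsCompact (toWeakSpace ℝ E '' A)}

/-- `C` is the Hukuhara difference `A ⊖ B` of the nonempty convex weakly compact sets `A` and `B`:
it is nonempty, convex and closed, and `B + C = A` (Minkowski sum). By the cancellation law there is
at most one such `C`. -/
structure IsHukuharaDiff {E : Type*} [NormedAddCommGroup E] [NormedSpace ℝ E]
    (A B C : Set E) : Prop where
  left_mem : A ∈ convexWeaklyCompacts E
  right_mem : B ∈ convexWeaklyCompacts E
  nonempty : C.Nonempty
  convex : Convex ℝ C
  isClosed : IsClosed C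
  add_eq : B + C = A

/-- Measurability of a set-valued map with respect to a σ-algebra `m`: the set of points where the
value meets a given open set belongs to `m`. -/
def SetValuedMeasurable {Ω E : Type*} [TopologicalSpace E] (m : MeasurableSpace Ω)
    (H : Ω → Set E) : Prop :=
  ∀ O : Set E, IsOpen O → MeasurableSet[m] {ω | (H ω ∩ O).Nonempty}

/-- The magnitude `|A| = sup_{x ∈ A} ‖x‖` of a set, with values in `[0, ∞]`. -/
noncomputable def setMagnitude {E : Type*} [NormedAddCommGroup E] (A : Set E) : ℝ≥0∞ :=
  ⨆ x ∈ A, ‖x‖ₑ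

/-- `G` is `p`-integrably bounded: its magnitude is almost everywhere dominated by a real function
in `L^p`. -/
def IntegrablyBounded {Ω E : Type*} [NormedAddCommGroup E] {mΩ : MeasurableSpace Ω}
    (p : ℝ≥0∞) (μ : Measure Ω) (G : Ω → Set E) : Prop :=
  ∃ v : Ω → ℝ, MemLp v p μ ∧ ∀ᵐ ω ∂μ, setMagnitude (G ω) ≤ ENNReal.ofReal (v ω)

/-- The subtrajectory integrals `S^p_m(G)`: the elements of `L^p(Ω, m; E)`, seen as a subspace of
`L^p(Ω; E)`, that are almost everywhere selections of `G`. -/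
def lpSelections {Ω E : Type*} [NormedAddCommGroup E] (m : MeasurableSpace Ω)
    {mΩ : MeasurableSpace Ω} (p : ℝ≥0∞) (μ : Measure Ω) (G : Ω → Set E) : Set (Lp E p μ) :=
  {g | AEStronglyMeasurable[m] g μ ∧ ∀ᵐ ω ∂μ, g ω ∈ G ω}

/-- `M` is (a version of) the set-valued conditional expectation of `G` given the sub-σ-algebra `m`:
an `m`-measurable map with nonempty closed values whose `L^p`-selections form the `L^p`-closure of
the set of the conditional expectations of the `L^p`-selections of `G`. -/
structure IsSetCondExp {Ω E : Type*} [NormedAddCommGroup E] [NormedSpace ℝ E] [CompleteSpace E]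
    (m : MeasurableSpace Ω) {mΩ : MeasurableSpace Ω} (p : ℝ≥0∞) [Fact (1 ≤ p)] (μ : Measure Ω)
    (G M : Ω → Set E) : Prop where
  nonempty : ∀ ω, (M ω).Nonempty
  isClosed : ∀ ω, IsClosed (M ω)
  measurable : SetValuedMeasurable m M
  selections_eq : lpSelections m p μ M =
    closure {f : Lp E p μ | ∃ g ∈ lpSelections mΩ p μ G, f =ᵐ[μ] μ[g | m]}

/-! Measurability is read off support functions. Since Φ₂ + Ψ = Φ₁, the support function of Ψ at any
functional is the difference of those of Φ₁ and Φ₂, hence measurable. A separable reflexive space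
has a separable dual, so by Hahn–Banach countably many functionals decide whether a value of Ψ meets
a given ball (`not_nonempty_inter_ball_iff`), and balls suffice.

For conditional expectations the claim is additivity: E(Φ₂) + E(Ψ) = E(Φ₂ + Ψ) = E(Φ₁). Existence
rests on decomposability: conditioning commutes with gluing along sets of the smaller σ-algebra, so
the closed set of conditioned selections is decomposable and therefore comes from a measurable map
(`IsDecomposable.exists_lpSelections_eq`). Additivity is first proved for sets of selections, by
linearity and continuity of conditional expectation on L^p, and then transferred to values through
countable dense families of selections (`IsSetCondExp.ae_add_eq`).

Convexity and boundedness of the values are transferred in the same way. Reflexivity turns closed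
bounded convex values into weakly compact ones, and this makes the Minkowski sum closed, so that the
identity holds without a closure. -/

/-- A set-valued map is measurable as soon as the sets of points where it meets an open ball are. -/
theorem SetValuedMeasurable.of_ball {E : Type*} [PseudoMetricSpace E]
    [TopologicalSpace.SeparableSpace E]
    {Ω : Type*} {m : MeasurableSpace Ω} {H : Ω → Set E}
    (h : ∀ (x : E) (r : ℝ), 0 < r → MeasurableSet[m] {ω | (H ω ∩ Metric.ball x r).Nonempty}) :
    SetValuedMeasurable m H := by
  intro O hO
  rcases isEmpty_or_nonempty E with hEmp | hNe
  · convert! MeasurableSet.empty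
    ext ω
    simp [Set.Nonempty]
  let x := TopologicalSpace.denseSeq E
  have heq : {ω | (H ω ∩ O).Nonempty} = ⋃ (n : ℕ) (k : ℕ)
      (_ : Metric.ball (x n) (1 / (k + 1)) ⊆ O),
        {ω | (H ω ∩ Metric.ball (x n) (1 / (k + 1))).Nonempty} := by
    ext ω
    simp only [mem_ofPred_eq, mem_iUnion, exists_prop]
    constructor
    · rintro ⟨y, hyH, hyO⟩
      obtain ⟨ε, hε, hball⟩ := Metric.isOpen_iff.1 hO y hyO
      obtain ⟨k, hk⟩ := exists_nat_one_div_lt (half_pos hε)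
      obtain ⟨n, hn⟩ := (TopologicalSpace.denseRange_denseSeq E).exists_dist_lt y
        (show (0 : ℝ) < 1 / (k + 1) by positivity)
      refine ⟨n, k, fun z hz => hball ?_, y, hyH, hn⟩
      rw [Metric.mem_ball] at hz ⊢
      have := dist_triangle z (x n) y
      rw [dist_comm (x n) y] at this
      have hn' : dist y (x n) < 1 / (k + 1) := hn
      linarith
    · rintro ⟨n, k, hsub, y, hyH, hy⟩
      exact ⟨y, hyH, hsub hy⟩
  rw [heq]
  exact MeasurableSet.iUnion fun n => MeasurableSet.iUnion fun k => MeasurableSet.iUnion fun _ =>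
    h _ _ (by positivity)

/-! ### Weak compactness, support functions and measurability of the difference -/

section Reflexive

variable {E : Type*} [NormedAddCommGroup E] [NormedSpace ℝ E]

/-- A normed space with separable dual is separable. -/
theorem separableSpace_of_separableSpace_dual
    [TopologicalSpace.SeparableSpace (StrongDual ℝ E)] : TopologicalSpace.SeparableSpace E := by
  let f : ℕ → StrongDual ℝ E := TopologicalSpace.denseSeq (StrongDual ℝ E)
  have hf : DenseRange f := TopologicalSpace.denseRange_denseSeq _
  have key : ∀ n, ∃ x : E, ‖x‖ ≤ 1 ∧ ‖f n‖ / 2 ≤ ‖f n x‖ := by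
    intro n
    by_contra! h
    have hle : ‖f n‖ ≤ ‖f n‖ / 2 := by
      refine ContinuousLinearMap.opNorm_le_of_unit_norm (by positivity) fun x hx => ?_
      exact (h x hx.le).le
    have hz : ‖f n‖ = 0 := le_antisymm (by linarith) (norm_nonneg _)
    have := h 0 (by simp)
    simp [hz] at this
  choose x hx1 hx2 using key
  let W : Submodule ℝ E := (Submodule.span ℝ (range x)).topologicalClosure
  have hW : W = ⊤ := by
    by_contra hne
    obtain ⟨y, hy⟩ : ∃ y, y ∉ W := by
      by_contra! h
      exact hne ((Submodule.eq_top_iff').2 h)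
    obtain ⟨g, u, hgu, hug⟩ := geometric_hahn_banach_closed_point (s := (W : Set E)) W.convex
      (Submodule.isClosed_topologicalClosure _) hy
    have hg0 : ∀ w ∈ W, g w = 0 := by
      intro w hw
      by_contra hgw
      have := hgu (((u + 1) / g w) • w) (W.smul_mem _ hw)
      rw [map_smul, smul_eq_mul, div_mul_cancel₀ _ hgw] at this
      linarith
    have hu : 0 < u := by simpa using hgu 0 W.zero_mem
    have hgpos : 0 < ‖g‖ := norm_pos_iff.2 fun h => by
      rw [h] at hug; simp at hug; linarith
    -- As `g` vanishes at `x n`, the choice of `x n` gives ‖f n‖ / 2 ≤ ‖g - f n‖, hence ‖g‖ ≤ 3‖g -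
    -- f n‖. Any approximation closer than ‖g‖ / 3 is contradictory.
    obtain ⟨n, hn⟩ := hf.exists_dist_lt g (show (0 : ℝ) < ‖g‖ / 4 by positivity)
    rw [dist_eq_norm] at hn
    have hxW : x n ∈ W := Submodule.le_topologicalClosure _ (Submodule.subset_span ⟨n, rfl⟩)
    have h1 : ‖f n (x n)‖ ≤ ‖g - f n‖ := by
      have := (g - f n).le_opNorm (x n)
      rw [sub_apply, hg0 _ hxW, zero_sub, norm_neg] at this
      nlinarith [hx1 n, norm_nonneg (g - f n)]
    have h2 : ‖g‖ ≤ ‖f n‖ + ‖g - f n‖ := by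
      simpa [add_comm] using norm_le_norm_add_norm_sub' g (f n)
    linarith [hx2 n]
  have hsep : TopologicalSpace.IsSeparable (W : Set E) := by
    simpa [W] using ((countable_range x).isSeparable.span (R := ℝ)).closure
  rw [hW] at hsep
  exact TopologicalSpace.isSeparable_univ_iff.1 (by simpa using hsep)

/-- The dual of a separable reflexive space is separable. -/
theorem separableSpace_dual_of_reflexive [TopologicalSpace.SeparableSpace E]
    (hE : Function.Surjective (NormedSpace.inclusionInDoubleDual ℝ E)) :
    TopologicalSpace.SeparableSpace (StrongDual ℝ E) := by
  -- By reflexivity the bidual is a continuous image of `E`.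
  have : TopologicalSpace.SeparableSpace (StrongDual ℝ (StrongDual ℝ E)) :=
    hE.denseRange.separableSpace (NormedSpace.inclusionInDoubleDual ℝ E).continuous
  exact separableSpace_of_separableSpace_dual

theorem isClosed_of_isCompact_toWeakSpace {A : Set E} (hA : IsCompact (toWeakSpace ℝ E '' A)) :
    IsClosed A := by
  have := hA.isClosed.preimage (toWeakSpaceCLM ℝ E).continuous
  have h2 : (toWeakSpaceCLM ℝ E) ⁻¹' (toWeakSpace ℝ E '' A) = A :=
    preimage_image_eq A (toWeakSpace ℝ E).injective
  rwa [h2] at this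

theorem isBounded_image_of_isCompact_toWeakSpace {A : Set E}
    (hA : IsCompact (toWeakSpace ℝ E '' A)) (f : StrongDual ℝ E) :
    Bornology.IsBounded (f '' A) := by
  have hc : Continuous fun y : WeakSpace ℝ E => f ((toWeakSpace ℝ E).symm y) :=
    WeakBilin.eval_continuous (topDualPairing ℝ E).flip f
  have := (hA.image hc).isBounded
  rwa [image_image] at this

/-- Uniform boundedness, with the points of `A` regarded as functionals on the dual; the dual is
always complete, so `E` need not be. -/
theorem isBounded_of_isCompact_toWeakSpace {A : Set E}
    (hA : IsCompact (toWeakSpace ℝ E '' A)) : Bornology.IsBounded A := by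
  have hpt : ∀ f : StrongDual ℝ E, ∃ C, ∀ a : A,
      ‖NormedSpace.inclusionInDoubleDual ℝ E (a : E) f‖ ≤ C := by
    intro f
    obtain ⟨C, hC⟩ := (isBounded_image_of_isCompact_toWeakSpace hA f).exists_norm_le
    exact ⟨C, fun a => hC _ ⟨a, a.2, rfl⟩⟩
  obtain ⟨C, hC⟩ := banach_steinhaus hpt
  refine isBounded_iff_forall_norm_le.2 ⟨C, fun a ha => ?_⟩
  rw [← (NormedSpace.inclusionInDoubleDualLi (E := E) ℝ).norm_map a]
  exact hC ⟨a, ha⟩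

/-- In a reflexive space, bounded closed convex sets are weakly compact. -/
theorem isCompact_toWeakSpace_of_reflexive
    (hE : Function.Surjective (NormedSpace.inclusionInDoubleDual ℝ E)) {A : Set E}
    (hconv : Convex ℝ A) (hclosed : IsClosed A) (hb : Bornology.IsBounded A) :
    IsCompact (toWeakSpace ℝ E '' A) := by
  -- Banach–Alaoglu in the bidual: the side condition that limit points come from `E` is
  -- reflexivity. The weak closure then equals the norm closure by convexity.
  have h := NormedSpace.isCompact_closure_of_isBounded ℝ E (toWeakSpace ℝ E '' A)
    (by rwa [preimage_image_eq A (toWeakSpace ℝ E).injective]) (by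
      rintro y -
      obtain ⟨x, hx⟩ := hE (WeakDual.toStrongDual y)
      refine ⟨toWeakSpace ℝ E x, ?_⟩
      exact DFunLike.ext _ _ fun f => congrArg (fun g => g f) hx)
  rwa [← hconv.toWeakSpace_closure ℝ, hclosed.closure_eq] at h

theorem mem_convexWeaklyCompacts_of_reflexive
    (hE : Function.Surjective (NormedSpace.inclusionInDoubleDual ℝ E)) {A : Set E}
    (hne : A.Nonempty) (hconv : Convex ℝ A) (hclosed : IsClosed A) (hb : Bornology.IsBounded A) :
    A ∈ convexWeaklyCompacts E :=
  ⟨hne, hconv, isCompact_toWeakSpace_of_reflexive hE hconv hclosed hb⟩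

theorem isClosed_add_of_mem_convexWeaklyCompacts {A B : Set E}
    (hA : A ∈ convexWeaklyCompacts E) (hB : B ∈ convexWeaklyCompacts E) : IsClosed (A + B) := by
  apply isClosed_of_isCompact_toWeakSpace
  rw [image_add]
  exact hA.2.2.add hB.2.2

namespace IsHukuharaDiff

variable {A B C : Set E}

theorem isBounded (h : IsHukuharaDiff A B C) : Bornology.IsBounded C := by
  obtain ⟨b, hb⟩ := h.right_mem.1
  have hsub : C ⊆ (fun x => x - b) '' A := fun c hc =>
    ⟨b + c, h.add_eq ▸ add_mem_add hb hc, by simp⟩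
  refine Bornology.IsBounded.subset ?_ hsub
  have : (fun x => x - b) '' A = A - {b} := by simp
  rw [this]
  exact (isBounded_of_isCompact_toWeakSpace h.left_mem.2.2).sub Bornology.isBounded_singleton

/-- Support functions are additive under Minkowski sums, and boundedness makes them finite, so they
can be subtracted. -/
theorem sSup_image_eq (h : IsHukuharaDiff A B C) (f : StrongDual ℝ E) :
    sSup (f '' C) = sSup (f '' A) - sSup (f '' B) := by
  have hbB := (isBounded_image_of_isCompact_toWeakSpace h.right_mem.2.2 f).bddAbove
  have hbC : BddAbove (f '' C) := (f.lipschitz.isBounded_image h.isBounded).bddAbove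
  rw [← h.add_eq, image_add, csSup_add (h.right_mem.1.image f) hbB (h.nonempty.image f) hbC]
  ring

end IsHukuharaDiff

/-- A convex bounded set misses an open ball iff it is separated from all the smaller concentric
balls by functionals taken from a given dense sequence. -/
theorem not_nonempty_inter_ball_iff {C : Set E} (hne : C.Nonempty) (hconv : Convex ℝ C)
    (hb : Bornology.IsBounded C) {f : ℕ → StrongDual ℝ E} (hf : DenseRange f) (x : E) {r : ℝ}
    (hr : 0 < r) :
    ¬ (C ∩ Metric.ball x r).Nonempty ↔
      ∀ k : ℕ, ∃ n, sSup (f n '' C) < f n x - (r - 1 / (k + 1)) * ‖f n‖ := by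
  constructor
  · intro hdisj k
    have hd : Disjoint (Metric.ball x r) C := by
      rw [disjoint_iff_inter_eq_empty, inter_comm]
      exact not_nonempty_iff_eq_empty.1 hdisj
    obtain ⟨g₀, u, h1, h2⟩ := geometric_hahn_banach_open (convex_ball x r) Metric.isOpen_ball
      hconv hd
    set g := -g₀ with hg
    -- The sign of the separating functional is flipped so that its supremum is taken over `C`,
    -- where it is at most `-u`.
    obtain ⟨R, hR⟩ := hb.exists_norm_le
    have hgC : ∀ c ∈ C, g c ≤ -u := fun c hc => by simpa [hg] using h2 c hc
    obtain ⟨c₀, hc₀⟩ := hne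
    have hgne : 0 < ‖g‖ := norm_pos_iff.2 fun h0 => by
      have h3 := h1 x (Metric.mem_ball_self hr)
      have h4 := h2 c₀ hc₀
      have : g₀ = 0 := by simpa [hg] using h0
      simp [this] at h3 h4
      linarith
    have hball : r * ‖g‖ ≤ g x + u := by
      have hcl : ∀ y ∈ Metric.closedBall x r, -g y ≤ u := by
        rw [← closure_ball x hr.ne']
        refine closure_minimal (t := {y | -g y ≤ u}) (fun y hy => ?_)
          (isClosed_le g.continuous.neg continuous_const)
        simpa [hg] using (h1 y hy).le
      have : ‖g‖ ≤ (g x + u) / r := by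
        refine ContinuousLinearMap.opNorm_bound_of_ball_bound hr _ g fun z hz => ?_
        have hz' : ‖z‖ ≤ r := by simpa using hz
        have h3 := hcl (x + z) (by simpa using hz')
        have h4 := hcl (x - z) (by simpa [Metric.mem_closedBall, dist_eq_norm] using hz')
        rw [map_add] at h3
        rw [map_sub] at h4
        rw [Real.norm_eq_abs, abs_le]
        constructor <;> linarith
      rwa [le_div_iff₀ hr, mul_comm] at this
    set s : ℝ := r - 1 / (k + 1) with hs
    have hk : (0 : ℝ) < 1 / (k + 1) := by positivity
    -- Shrinking the radius by 1/(k+1) leaves a gap of ‖g‖/(k+1). Replacing `g` by `f n` costs at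
    -- most η(|R| + ‖x‖ + |s|), from `C`, the centre and the norm term; this η spends at most half
    -- of the gap.
    set η : ℝ := (1 / (k + 1) * ‖g‖) / (2 * (|R| + ‖x‖ + |s| + 1)) with hη
    have hden : 0 < |R| + ‖x‖ + |s| + 1 := by positivity
    have hηpos : 0 < η := by positivity
    obtain ⟨n, hn⟩ := hf.exists_dist_lt g hηpos
    rw [dist_comm, dist_eq_norm] at hn
    have hval : ∀ y : E, |f n y - g y| ≤ η * ‖y‖ := fun y => by
      have := (f n - g).le_opNorm y
      rw [sub_apply, Real.norm_eq_abs] at this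
      exact this.trans (by gcongr)
    have hnorm : |‖f n‖ - ‖g‖| ≤ η := (abs_norm_sub_norm_le _ _).trans hn.le
    have hηeq : η * (|R| + ‖x‖ + |s| + 1) = 1 / (k + 1) * ‖g‖ / 2 := by
      rw [hη]; field_simp
    have hsup : sSup (f n '' C) ≤ -u + η * |R| := by
      refine csSup_le (Nonempty.image _ ⟨c₀, hc₀⟩) ?_
      rintro _ ⟨c, hc, rfl⟩
      have h3 := (abs_le.1 (hval c)).2
      have h4 : η * ‖c‖ ≤ η * |R| := by
        gcongr; exact (hR c hc).trans (le_abs_self R)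
      linarith [hgC c hc]
    have hx := (abs_le.1 (hval x)).1
    have hsn : s * ‖f n‖ ≤ s * ‖g‖ + |s| * η := by
      have : s * (‖f n‖ - ‖g‖) ≤ |s| * η := by
        refine (le_abs_self _).trans ?_
        rw [abs_mul]
        gcongr
      linarith
    refine ⟨n, ?_⟩
    have hsg : s * ‖g‖ = r * ‖g‖ - 1 / (k + 1) * ‖g‖ := by rw [hs]; ring
    have : 0 < 1 / ((k : ℝ) + 1) * ‖g‖ := by positivity
    nlinarith
  · rintro h ⟨y, hyC, hy⟩
    rw [Metric.mem_ball, dist_eq_norm] at hy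
    obtain ⟨k, hk⟩ := exists_nat_one_div_lt (sub_pos.2 hy)
    obtain ⟨n, hn⟩ := h k
    have hle : f n y ≤ sSup (f n '' C) :=
      le_csSup ((f n).lipschitz.isBounded_image hb).bddAbove ⟨y, hyC, rfl⟩
    have h1 : f n x - f n y ≤ ‖f n‖ * ‖y - x‖ := by
      rw [← map_sub, norm_sub_rev]
      exact (le_abs_self _).trans ((f n).le_opNorm _)
    have h2 : ‖f n‖ * ‖y - x‖ ≤ ‖f n‖ * (r - 1 / (k + 1)) := by
      gcongr; linarith
    linarith

/-- The supremum exceeds `a` exactly when the value meets the open half-space where `f` exceeds `a`.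
-/
theorem measurable_sSup_image {Ω : Type*} {m : MeasurableSpace Ω} {H : Ω → Set E}
    (hH : ∀ ω, H ω ∈ convexWeaklyCompacts E) (hm : SetValuedMeasurable m H) (f : StrongDual ℝ E) :
    Measurable fun ω => sSup (f '' H ω) := by
  refine measurable_of_Ioi fun a => ?_
  have : (fun ω => sSup (f '' H ω)) ⁻¹' Ioi a = {ω | (H ω ∩ f ⁻¹' Ioi a).Nonempty} := by
    ext ω
    rw [mem_preimage, mem_Ioi, lt_csSup_iff
      (isBounded_image_of_isCompact_toWeakSpace (hH ω).2.2 f).bddAbove ((hH ω).1.image f)]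
    simp [Set.Nonempty]
  rw [this]
  exact hm _ (isOpen_Ioi.preimage f.continuous)

/-- The Hukuhara difference of measurable set-valued maps with weakly compact convex values in a
separable reflexive space is measurable. -/
theorem SetValuedMeasurable.hukuharaDiff [TopologicalSpace.SeparableSpace E]
    (hE : Function.Surjective (NormedSpace.inclusionInDoubleDual ℝ E))
    {Ω : Type*} {m : MeasurableSpace Ω} {F G H : Ω → Set E}
    (hF : SetValuedMeasurable m F) (hG : SetValuedMeasurable m G)
    (hH : ∀ ω, IsHukuharaDiff (F ω) (G ω) (H ω)) : SetValuedMeasurable m H := by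
  have := separableSpace_dual_of_reflexive hE
  let f := TopologicalSpace.denseSeq (StrongDual ℝ E)
  have hs : ∀ n, Measurable fun ω => sSup (f n '' H ω) := fun n => by
    simp_rw [(hH _).sSup_image_eq]
    exact (measurable_sSup_image (fun ω => (hH ω).left_mem) hF _).sub
      (measurable_sSup_image (fun ω => (hH ω).right_mem) hG _)
  refine SetValuedMeasurable.of_ball fun x r hr => MeasurableSet.of_compl ?_
  have : {ω | (H ω ∩ Metric.ball x r).Nonempty}ᶜ =
      ⋂ k : ℕ, ⋃ n, {ω | sSup (f n '' H ω) < f n x - (r - 1 / (k + 1)) * ‖f n‖} := by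
    ext ω
    rw [mem_compl_iff, mem_ofPred_eq, not_nonempty_inter_ball_iff (hH ω).nonempty (hH ω).convex
      (hH ω).isBounded (TopologicalSpace.denseRange_denseSeq _) x hr]
    simp [f]
  rw [this]
  exact MeasurableSet.iInter fun k => MeasurableSet.iUnion fun n =>
    measurableSet_lt (hs n) measurable_const

end Reflexive

/-! ### Measurable selections and Castaing representation -/

section Castaing

open Filter Topology

variable {Ω E : Type*} {m : MeasurableSpace Ω} [MetricSpace E]
  {H : Ω → Set E} {x : ℕ → E}

/-- One refinement step of the Kuratowski–Ryll-Nardzewski construction. -/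
theorem exists_measurable_index_refine (hm : SetValuedMeasurable m H) (hx : DenseRange x) {r : ℝ}
    (hr : 0 < r) {N : Ω → ℕ} (hN : Measurable N)
    (hNH : ∀ ω, (H ω ∩ Metric.ball (x (N ω)) r).Nonempty) :
    ∃ N' : Ω → ℕ, Measurable N' ∧ (∀ ω, (H ω ∩ Metric.ball (x (N' ω)) (r / 2)).Nonempty) ∧
      ∀ ω, dist (x (N ω)) (x (N' ω)) ≤ 2 * r := by
  classical
  -- Taking the least admissible index keeps the choice measurable.
  let P : Ω → ℕ → Prop := fun ω n =>
    (H ω ∩ Metric.ball (x n) (r / 2)).Nonempty ∧ dist (x (N ω)) (x n) ≤ 2 * r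
  have hP : ∀ ω, ∃ n, P ω n := by
    intro ω
    obtain ⟨y, hyH, hy⟩ := hNH ω
    obtain ⟨n, hn⟩ := hx.exists_dist_lt y (half_pos hr)
    refine ⟨n, ⟨y, hyH, hn⟩, ?_⟩
    have := dist_triangle (x (N ω)) y (x n)
    rw [Metric.mem_ball, dist_comm] at hy
    linarith
  refine ⟨fun ω => Nat.find (hP ω), measurable_find hP fun n => ?_,
    fun ω => (Nat.find_spec (hP ω)).1, fun ω => (Nat.find_spec (hP ω)).2⟩
  exact (hm _ Metric.isOpen_ball).inter
    (hN (MeasurableSet.of_discrete (s := {k | dist (x k) (x n) ≤ 2 * r})))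

/-- A measurable set-valued map with nonempty closed values in a complete space has a strongly
measurable selection that is near a given point of the dense sequence whenever possible. -/
theorem exists_stronglyMeasurable_selection_near [CompleteSpace E]
    (hm : SetValuedMeasurable m H) (hne : ∀ ω, (H ω).Nonempty) (hcl : ∀ ω, IsClosed (H ω))
    (hx : DenseRange x) (i : ℕ) {r : ℝ} (hr : 0 < r) :
    ∃ h : Ω → E, StronglyMeasurable h ∧ (∀ ω, h ω ∈ H ω) ∧
      ∀ ω, (H ω ∩ Metric.ball (x i) r).Nonempty → dist (x i) (h ω) ≤ 4 * r := by
  classical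
  -- The starting index is forced to be `i` whenever possible, so that the limit stays near `x i`.
  obtain ⟨N₀, hN₀, hN₀H, hN₀i⟩ : ∃ N₀ : Ω → ℕ, Measurable N₀ ∧
      (∀ ω, (H ω ∩ Metric.ball (x (N₀ ω)) r).Nonempty) ∧
      ∀ ω, (H ω ∩ Metric.ball (x i) r).Nonempty → N₀ ω = i := by
    have hP : ∀ ω, ∃ n, (H ω ∩ Metric.ball (x n) r).Nonempty := by
      intro ω
      obtain ⟨y, hy⟩ := hne ω
      obtain ⟨n, hn⟩ := hx.exists_dist_lt y hr
      exact ⟨n, y, hy, hn⟩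
    refine ⟨fun ω => if (H ω ∩ Metric.ball (x i) r).Nonempty then i else Nat.find (hP ω),
      Measurable.ite (hm _ Metric.isOpen_ball) measurable_const
        (measurable_find hP fun n => hm _ Metric.isOpen_ball), fun ω => ?_, fun ω h => if_pos h⟩
    by_cases h : (H ω ∩ Metric.ball (x i) r).Nonempty
    · simpa only [if_pos h] using h
    · simpa only [if_neg h] using Nat.find_spec (hP ω)
  have step : ∀ (k : ℕ) (N : {N : Ω → ℕ // Measurable N ∧
      ∀ ω, (H ω ∩ Metric.ball (x (N ω)) (r / 2 ^ k)).Nonempty}),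
      ∃ N' : {N : Ω → ℕ // Measurable N ∧
        ∀ ω, (H ω ∩ Metric.ball (x (N ω)) (r / 2 ^ (k + 1))).Nonempty},
        ∀ ω, dist (x (N.1 ω)) (x (N'.1 ω)) ≤ 2 * (r / 2 ^ k) := by
    rintro k ⟨N, hN, hNH⟩
    obtain ⟨N', h1, h2, h3⟩ := exists_measurable_index_refine hm hx (by positivity) hN hNH
    refine ⟨⟨N', h1, fun ω => ?_⟩, h3⟩
    rw [pow_succ, ← div_div]
    exact h2 ω
  choose next hnext using step
  let N : ∀ k : ℕ, {N : Ω → ℕ // Measurable N ∧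
      ∀ ω, (H ω ∩ Metric.ball (x (N ω)) (r / 2 ^ k)).Nonempty} :=
    fun k => Nat.rec ⟨N₀, hN₀, by simpa using hN₀H⟩ next k
  -- This form of the bound fits the geometric lemmas, which give total displacement at most 4r.
  have hdist : ∀ ω k, dist (x ((N k).1 ω)) (x ((N (k + 1)).1 ω)) ≤ 4 * r / 2 / 2 ^ k := by
    intro ω k
    have := hnext k (N k) ω
    calc _ ≤ _ := this
      _ = _ := by ring
  have hlim : ∀ ω, ∃ a, Tendsto (fun k => x ((N k).1 ω)) atTop (𝓝 a) := fun ω =>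
    cauchySeq_tendsto_of_complete (cauchySeq_of_le_geometric_two (hdist ω))
  choose h hh using hlim
  have hpow : Tendsto (fun k : ℕ => r / 2 ^ k) atTop (𝓝 0) := by
    have := (tendsto_pow_atTop_nhds_zero_of_lt_one (r := (1 / 2 : ℝ)) (by norm_num)
      (by norm_num)).const_mul r
    simpa [div_eq_mul_inv] using this
  refine ⟨h, ?_, fun ω => ?_, fun ω hω => ?_⟩
  · refine stronglyMeasurable_of_tendsto atTop (f := fun k ω => x ((N k).1 ω)) (fun k => ?_)
      (tendsto_pi_nhds.2 hh)
    exact (StronglyMeasurable.of_discrete (f := x)).comp_measurable (N k).2.1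
  · have hpt : ∀ k, ∃ y ∈ H ω, dist y (x ((N k).1 ω)) < r / 2 ^ k := fun k => (N k).2.2 ω
    choose y hyH hy using hpt
    refine (hcl ω).mem_of_tendsto (f := y) (b := atTop) ?_ (Eventually.of_forall hyH)
    refine (tendsto_iff_of_dist ?_).1 (hh ω)
    refine squeeze_zero (fun _ => dist_nonneg) (fun k => ?_) hpow
    rw [dist_comm]
    exact (hy k).le
  · have := dist_le_of_le_geometric_two_of_tendsto₀ (hdist ω) (hh ω)
    have h0 : (N 0).1 ω = i := hN₀i ω hω
    rwa [h0] at this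

/-- **Castaing representation**: a measurable set-valued map with nonempty closed values in a
separable complete space is the closure of countably many strongly measurable selections. -/
theorem exists_castaing_representation [CompleteSpace E] [TopologicalSpace.SeparableSpace E]
    (hm : SetValuedMeasurable m H) (hne : ∀ ω, (H ω).Nonempty) (hcl : ∀ ω, IsClosed (H ω)) :
    ∃ h : ℕ → Ω → E, (∀ n, StronglyMeasurable (h n)) ∧ (∀ n ω, h n ω ∈ H ω) ∧
      ∀ ω, H ω ⊆ closure (range fun n => h n ω) := by
  rcases isEmpty_or_nonempty Ω with hΩ | ⟨⟨ω₀⟩⟩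
  · exact ⟨fun _ ω => hΩ.elim ω, fun _ => StronglyMeasurable.of_subsingleton_dom,
      fun _ ω => hΩ.elim ω, fun ω => hΩ.elim ω⟩
  have : Nonempty E := ⟨(hne ω₀).some⟩
  let x := TopologicalSpace.denseSeq E
  have hx : DenseRange x := TopologicalSpace.denseRange_denseSeq E
  have key : ∀ q : ℕ, ∃ h : Ω → E, StronglyMeasurable h ∧ (∀ ω, h ω ∈ H ω) ∧
      ∀ ω, (H ω ∩ Metric.ball (x q.unpair.1) (1 / (q.unpair.2 + 1))).Nonempty →
        dist (x q.unpair.1) (h ω) ≤ 4 * (1 / (q.unpair.2 + 1)) := fun q =>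
    exists_stronglyMeasurable_selection_near hm hne hcl hx _ (by positivity)
  choose h h1 h2 h3 using key
  refine ⟨h, h1, h2, fun ω z hz => Metric.mem_closure_range_iff.2 fun ε hε => ?_⟩
  -- One radius from `z` to the centre plus four from the centre to the selection.
  obtain ⟨j, hj⟩ := exists_nat_one_div_lt (show 0 < ε / 5 by positivity)
  obtain ⟨i, hi⟩ := hx.exists_dist_lt z (show (0 : ℝ) < 1 / (j + 1) by positivity)
  refine ⟨Nat.pair i j, ?_⟩
  have h4 := h3 (Nat.pair i j) ω
  rw [Nat.unpair_pair] at h4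
  have h5 := h4 ⟨z, hz, hi⟩
  have := dist_triangle z (x i) (h (Nat.pair i j) ω)
  dsimp only at h5
  linarith

end Castaing

/-! ### Dense families of L^p selections -/

section LpCastaing

variable {Ω E : Type*} [NormedAddCommGroup E] {m mΩ : MeasurableSpace Ω} {p : ℝ≥0∞}
  {μ : Measure Ω} {H : Ω → Set E}

/-- Two functions of `L^p` can be glued along a measurable set. -/
theorem exists_Lp_glue {A : Set Ω} (hA : MeasurableSet A) (f g : Lp E p μ) :
    ∃ h : Lp E p μ, (∀ᵐ ω ∂μ, ω ∈ A → h ω = f ω) ∧ (∀ᵐ ω ∂μ, ω ∉ A → h ω = g ω) := by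
  have h : MemLp (A.indicator f + Aᶜ.indicator g) p μ :=
    ((Lp.memLp f).indicator hA).add ((Lp.memLp g).indicator hA.compl)
  refine ⟨h.toLp, ?_, ?_⟩
  · filter_upwards [h.coeFn_toLp] with ω hω hωA
    simp [hω, hωA]
  · filter_upwards [h.coeFn_toLp] with ω hω hωA
    simp [hω, hωA]

/-- The `L^p` version of the Castaing representation, for a map with at least one `L^p`
selection. -/
theorem exists_lpSelections_dense [CompleteSpace E] [TopologicalSpace.SeparableSpace E]
    [IsFiniteMeasure μ] (hm : m ≤ mΩ) (hH : SetValuedMeasurable m H) (hne : ∀ ω, (H ω).Nonempty)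
    (hcl : ∀ ω, IsClosed (H ω)) (hS : (lpSelections m p μ H).Nonempty) :
    ∃ g : ℕ → Lp E p μ, (∀ n, g n ∈ lpSelections m p μ H) ∧
      ∀ᵐ ω ∂μ, H ω = closure (range fun n => g n ω) := by
  obtain ⟨h, h1, h2, h3⟩ := exists_castaing_representation hH hne hcl
  obtain ⟨f, ⟨f', hf', hff'⟩, hfH⟩ := hS
  -- Truncation: `h n` is kept where its norm is at most `k` and replaced elsewhere by the given L^p
  -- selection.
  have key : ∀ q : ℕ, ∃ g ∈ lpSelections m p μ H,
      ∀ᵐ ω ∂μ, ‖h q.unpair.1 ω‖ ≤ q.unpair.2 → g ω = h q.unpair.1 ω := by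
    intro q
    set n := q.unpair.1
    set k := q.unpair.2
    let A : Set Ω := {ω | ‖h n ω‖ ≤ k}
    have hA : MeasurableSet[m] A := (h1 n).norm.measurable measurableSet_Iic
    have hmem : MemLp (A.indicator (h n) + Aᶜ.indicator f') p μ := by
      refine MemLp.add (MemLp.of_bound ?_ k (ae_of_all _ fun ω => ?_)) ?_
      · exact (((h1 n).indicator hA).mono hm).aestronglyMeasurable
      · by_cases hω : ω ∈ A
        · have hle : ‖h n ω‖ ≤ k := hω
          simpa [hω] using hle
        · simp [hω]
      · exact ((memLp_congr_ae hff').1 (Lp.memLp f)).indicator (hm _ hA).compl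
    refine ⟨hmem.toLp, ⟨⟨_, ((h1 n).indicator hA).add (hf'.indicator hA.compl),
      hmem.coeFn_toLp⟩, ?_⟩, ?_⟩
    · filter_upwards [hmem.coeFn_toLp, hff', hfH] with ω hω hω' hωH
      rw [hω]
      by_cases hωA : ω ∈ A
      · simpa [hωA] using h2 n ω
      · simpa [hωA, ← hω'] using hωH
    · filter_upwards [hmem.coeFn_toLp] with ω hω hωA
      have : ω ∈ A := hωA
      simp [hω, this]
  choose g hg hgh using key
  refine ⟨g, hg, ?_⟩
  filter_upwards [ae_all_iff.2 hgh, ae_all_iff.2 fun n => (hg n).2] with ω hω hωH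
  refine Subset.antisymm ((h3 ω).trans (closure_mono ?_))
    (closure_minimal (range_subset_iff.2 hωH) (hcl ω))
  rintro _ ⟨n, rfl⟩
  obtain ⟨k, hk⟩ := exists_nat_ge ‖h n ω‖
  have := hω (Nat.pair n k)
  rw [Nat.unpair_pair] at this
  exact ⟨Nat.pair n k, this hk⟩

/-- An integrably bounded measurable map with nonempty closed values has an `L^p` selection. -/
theorem IntegrablyBounded.lpSelections_nonempty [CompleteSpace E]
    [TopologicalSpace.SeparableSpace E] (hb : IntegrablyBounded p μ H)
    (hH : SetValuedMeasurable mΩ H) (hne : ∀ ω, (H ω).Nonempty) (hcl : ∀ ω, IsClosed (H ω)) :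
    (lpSelections mΩ p μ H).Nonempty := by
  obtain ⟨h, h1, h2, -⟩ := exists_castaing_representation hH hne hcl
  obtain ⟨v, hv, hvH⟩ := hb
  have hmem : MemLp (h 0) p μ := by
    refine hv.of_le (h1 0).aestronglyMeasurable ?_
    filter_upwards [hvH] with ω hω
    have h3 : ‖h 0 ω‖ₑ ≤ ENNReal.ofReal (v ω) :=
      (le_iSup₂ (f := fun x (_ : x ∈ H ω) => ‖x‖ₑ) _ (h2 0 ω)).trans hω
    rw [← enorm_le_iff_norm_le]
    exact h3.trans (by rw [← ofReal_norm]; exact ENNReal.ofReal_le_ofReal (Real.le_norm_self _))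
  exact ⟨hmem.toLp, Lp.aestronglyMeasurable _,
    hmem.coeFn_toLp.mono fun ω hω => hω ▸ h2 0 ω⟩

end LpCastaing

/-! ### Decomposable sets and their representation by set-valued maps -/

section Decomposable

open Filter Topology

variable {Ω E : Type*} [NormedAddCommGroup E] {m mΩ : MeasurableSpace Ω} {p : ℝ≥0∞}
  {μ : Measure Ω}

/-- A set of `L^p` functions is decomposable with respect to `m` if it is stable under gluing along
sets of `m`. -/
def IsDecomposable (m : MeasurableSpace Ω) {mΩ : MeasurableSpace Ω} {μ : Measure Ω}
    (D : Set (Lp E p μ)) : Prop :=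
  ∀ A : Set Ω, MeasurableSet[m] A → ∀ f ∈ D, ∀ g ∈ D, ∀ h : Lp E p μ,
    (∀ᵐ ω ∂μ, ω ∈ A → h ω = f ω) → (∀ᵐ ω ∂μ, ω ∉ A → h ω = g ω) → h ∈ D

theorem Lp_norm_le_add_of_glue [Fact (1 ≤ p)] {A : Set Ω} {f g h : Lp E p μ}
    (hf : ∀ᵐ ω ∂μ, ω ∈ A → h ω = f ω) (hg : ∀ᵐ ω ∂μ, ω ∉ A → h ω = g ω) :
    ‖h‖ ≤ ‖f‖ + ‖g‖ := by
  rw [Lp.norm_def, Lp.norm_def, Lp.norm_def,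
    ← ENNReal.toReal_add (Lp.eLpNorm_ne_top f) (Lp.eLpNorm_ne_top g)]
  refine ENNReal.toReal_mono
    (ENNReal.add_ne_top.2 ⟨Lp.eLpNorm_ne_top f, Lp.eLpNorm_ne_top g⟩) ?_
  have h1 : eLpNorm h p μ ≤ eLpNorm ((fun ω => ‖f ω‖) + fun ω => ‖g ω‖) p μ := by
    refine eLpNorm_mono_ae ?_
    filter_upwards [hf, hg] with ω h1 h2
    rw [Pi.add_apply, Real.norm_of_nonneg (by positivity)]
    by_cases hω : ω ∈ A
    · rw [h1 hω]; linarith [norm_nonneg (g ω)]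
    · rw [h2 hω]; linarith [norm_nonneg (f ω)]
  refine h1.trans ((eLpNorm_add_le (Lp.aestronglyMeasurable f).norm
    (Lp.aestronglyMeasurable g).norm Fact.out).trans ?_)
  rw [eLpNorm_norm, eLpNorm_norm]

theorem IsDecomposable.closure [Fact (1 ≤ p)] (hm : m ≤ mΩ) {D : Set (Lp E p μ)}
    (hD : IsDecomposable m D) : IsDecomposable m (closure D) := by
  intro A hA f hf g hg h hhf hhg
  refine Metric.mem_closure_iff.2 fun ε hε => ?_
  obtain ⟨f', hf', hff'⟩ := Metric.mem_closure_iff.1 hf (ε / 2) (half_pos hε)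
  obtain ⟨g', hg', hgg'⟩ := Metric.mem_closure_iff.1 hg (ε / 2) (half_pos hε)
  obtain ⟨h', h1, h2⟩ := exists_Lp_glue (hm _ hA) f' g'
  refine ⟨h', hD A hA f' hf' g' hg' h' h1 h2, ?_⟩
  rw [dist_eq_norm] at *
  have : ‖h - h'‖ ≤ ‖f - f'‖ + ‖g - g'‖ := by
    refine Lp_norm_le_add_of_glue (A := A) ?_ ?_
    · filter_upwards [hhf, h1, Lp.coeFn_sub h h', Lp.coeFn_sub f f'] with ω h3 h4 h5 h6 hω
      rw [h5, h6, Pi.sub_apply, Pi.sub_apply, h3 hω, h4 hω]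
    · filter_upwards [hhg, h2, Lp.coeFn_sub h h', Lp.coeFn_sub g g'] with ω h3 h4 h5 h6 hω
      rw [h5, h6, Pi.sub_apply, Pi.sub_apply, h3 hω, h4 hω]
  linarith

theorem isDecomposable_lpSelections (H : Ω → Set E) :
    IsDecomposable m (lpSelections m p μ H) := by
  rintro A hA f ⟨⟨f', hf', hff'⟩, hfH⟩ g ⟨⟨g', hg', hgg'⟩, hgH⟩ h h1 h2
  refine ⟨⟨A.indicator f' + Aᶜ.indicator g', (hf'.indicator hA).add (hg'.indicator hA.compl), ?_⟩,
    ?_⟩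
  · filter_upwards [h1, h2, hff', hgg'] with ω h3 h4 h5 h6
    by_cases hω : ω ∈ A
    · simp [hω, h3 hω, h5]
    · simp [hω, h4 hω, h6]
  · filter_upwards [h1, h2, hfH, hgH] with ω h3 h4 h5 h6
    by_cases hω : ω ∈ A
    · rwa [h3 hω]
    · rwa [h4 hω]

theorem IsDecomposable.add {D D' : Set (Lp E p μ)} (hm : m ≤ mΩ) (hD : IsDecomposable m D)
    (hD' : IsDecomposable m D') : IsDecomposable m (D + D') := by
  rintro A hA _ ⟨f, hf, f', hf', rfl⟩ _ ⟨g, hg, g', hg', rfl⟩ h h1 h2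
  obtain ⟨k, hk1, hk2⟩ := exists_Lp_glue (hm _ hA) f g
  obtain ⟨k', hk1', hk2'⟩ := exists_Lp_glue (hm _ hA) f' g'
  refine ⟨k, hD A hA f hf g hg k hk1 hk2, k', hD' A hA f' hf' g' hg' k' hk1' hk2', ?_⟩
  refine Lp.ext ?_
  filter_upwards [h1, h2, hk1, hk2, hk1', hk2', Lp.coeFn_add k k', Lp.coeFn_add f f',
    Lp.coeFn_add g g'] with ω h3 h4 h5 h6 h7 h8 h9 h10 h11
  rw [h9, Pi.add_apply]
  by_cases hω : ω ∈ A
  · rw [h3 hω, h5 hω, h7 hω, h10, Pi.add_apply]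
  · rw [h4 hω, h6 hω, h8 hω, h11, Pi.add_apply]

/-- A measurable function whose values are almost everywhere limits of values of countably many
elements of a decomposable set lies in the `L^p` closure of this set. -/
theorem IsDecomposable.mem_closure_of_ae_mem_closure_range [Fact (1 ≤ p)] [IsProbabilityMeasure μ]
    (hp : p ≠ ∞) (hm : m ≤ mΩ) {D : Set (Lp E p μ)} (hD : IsDecomposable m D)
    {g : ℕ → Lp E p μ} (hgD : ∀ n, g n ∈ D) (hg : ∀ n, AEStronglyMeasurable[m] (g n) μ)
    {f : Lp E p μ} (hf : AEStronglyMeasurable[m] f μ)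
    (hfg : ∀ᵐ ω ∂μ, f ω ∈ _root_.closure (range fun n => g n ω)) : f ∈ _root_.closure D := by
  obtain ⟨f', hf', hff'⟩ := hf
  choose g' hg' hgg' using hg
  refine Metric.mem_closure_iff.2 fun ε hε => ?_
  let A : ℕ → Set Ω := fun n => {ω | dist (f' ω) (g' n ω) < ε / 4}
  have hA : ∀ n, MeasurableSet[m] (A n) := fun n =>
    (hf'.dist (hg' n)).measurable measurableSet_Iio
  let U : ℕ → Set Ω := fun K => ⋃ n < K, A n
  have hU : ∀ K, MeasurableSet[m] (U K) := fun K =>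
    MeasurableSet.iUnion fun n => MeasurableSet.iUnion fun _ => hA n
  -- Finitely many gluings stay in `D`: the result is close to `f` on `U K` and falls back to `g 0`
  -- elsewhere.
  have hstep : ∀ K, ∃ h ∈ D, (∀ᵐ ω ∂μ, ω ∈ U K → dist (f ω) (h ω) ≤ ε / 4) ∧
      ∀ᵐ ω ∂μ, ω ∉ U K → h ω = g 0 ω := by
    intro K
    induction K with
    | zero => exact ⟨g 0, hgD 0, by simp [U], by simp⟩
    | succ K ih =>
      obtain ⟨h, hhD, h1, h2⟩ := ih
      obtain ⟨k, hk1, hk2⟩ := exists_Lp_glue (hm _ (hA K)) (g K) h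
      have hUK : U (K + 1) = U K ∪ A K := biUnion_lt_succ A K
      refine ⟨k, hD _ (hA K) _ (hgD K) _ hhD k hk1 hk2, ?_, ?_⟩
      · filter_upwards [h1, hk1, hk2, hff', hgg' K] with ω h3 h4 h5 h6 h7 hω
        by_cases hωA : ω ∈ A K
        · rw [h4 hωA, h6, h7]
          exact le_of_lt hωA
        · rw [h5 hωA]
          exact h3 ((hUK ▸ hω).resolve_right hωA)
      · filter_upwards [h2, hk2] with ω h3 h4 hω
        rw [hUK, mem_union, not_or] at hω
        rw [h4 hω.2, h3 hω.1]
  -- Absolute continuity of the L^p norm, for finite `p`: the fallback region contributes little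
  -- once `(U K)ᶜ` has small measure.
  obtain ⟨δ, hδ, hδf⟩ := (Lp.memLp (f - g 0)).eLpNorm_indicator_le Fact.out hp
    (show 0 < ε / 4 by positivity)
  have hlim : Tendsto (fun K => μ (U K)ᶜ) atTop (𝓝 (μ (⋂ K, (U K)ᶜ))) := by
    refine tendsto_measure_iInter_atTop (fun K => (hm _ (hU K)).compl.nullMeasurableSet) ?_
      ⟨0, measure_ne_top _ _⟩
    intro K L hKL
    refine compl_subset_compl.2 ?_
    exact biUnion_subset_biUnion_left fun n hn => lt_of_lt_of_le hn hKL
  have hzero : μ (⋂ K, (U K)ᶜ) = 0 := by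
    refine measure_mono_null (t := {ω | ¬ ∃ n, ω ∈ A n}) (fun ω hω => ?_) (ae_iff.1 ?_)
    · rintro ⟨n, hn⟩
      exact mem_iInter.1 hω (n + 1) (mem_biUnion (Nat.lt_succ_self n) hn)
    · filter_upwards [hfg, hff', ae_all_iff.2 hgg'] with ω h1 h2 h3
      obtain ⟨n, hn⟩ := Metric.mem_closure_range_iff.1 h1 (ε / 4) (by positivity)
      rw [h2, h3 n] at hn
      exact ⟨n, hn⟩
  rw [hzero] at hlim
  obtain ⟨K, hK⟩ := (hlim.eventually (ge_mem_nhds (show (0 : ℝ≥0∞) < ENNReal.ofReal δ by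
    simpa using hδ))).exists
  obtain ⟨h, hhD, h1, h2⟩ := hstep K
  refine ⟨h, hhD, ?_⟩
  rw [dist_eq_norm, Lp.norm_def]
  have hle : eLpNorm (f - h : Lp E p μ) p μ ≤
      ENNReal.ofReal (ε / 4) + ENNReal.ofReal (ε / 4) := by
    have h3 : eLpNorm (f - h : Lp E p μ) p μ ≤
        eLpNorm ((fun _ => ε / 4) + fun ω => ‖(U K)ᶜ.indicator (f - g 0 : Lp E p μ) ω‖) p μ := by
      refine eLpNorm_mono_ae ?_
      filter_upwards [h1, h2, Lp.coeFn_sub f h, Lp.coeFn_sub f (g 0)] with ω h3 h4 h5 h6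
      rw [Pi.add_apply, Real.norm_of_nonneg (by positivity), h5, Pi.sub_apply]
      by_cases hω : ω ∈ U K
      · rw [← dist_eq_norm]
        exact (h3 hω).trans (by simp)
      · rw [h4 hω, indicator_of_mem (by exact hω), h6, Pi.sub_apply]
        linarith
    refine h3.trans ((eLpNorm_add_le aestronglyMeasurable_const
      ((Lp.aestronglyMeasurable _).indicator (hm _ (hU K)).compl).norm Fact.out).trans ?_)
    rw [eLpNorm_norm]
    refine add_le_add ?_ (hδf _ (hm _ (hU K)).compl hK)
    have hp0 : p ≠ 0 := (zero_lt_one.trans_le (Fact.out : 1 ≤ p)).ne'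
    rw [eLpNorm_const _ hp0 (NeZero.ne μ), measure_univ, ENNReal.one_rpow, mul_one,
      ← ofReal_norm, Real.norm_of_nonneg (by positivity)]
  rw [← ENNReal.ofReal_add (by positivity) (by positivity)] at hle
  have := ENNReal.toReal_mono ENNReal.ofReal_ne_top hle
  rw [ENNReal.toReal_ofReal (by positivity)] at this
  linarith

/-- **Hiai–Umegaki representation**: a nonempty closed decomposable set of `m`-measurable `L^p`
functions is the set of `L^p` selections of an `m`-measurable map with nonempty closed values. -/
theorem IsDecomposable.exists_lpSelections_eq [TopologicalSpace.SeparableSpace E]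
    [Fact (1 ≤ p)] [IsProbabilityMeasure μ] (hp : p ≠ ∞) (hm : m ≤ mΩ) {D : Set (Lp E p μ)}
    (hD : IsDecomposable m D) (hcl : IsClosed D) (hne : D.Nonempty)
    (hmeas : ∀ f ∈ D, AEStronglyMeasurable[m] f μ) :
    ∃ M : Ω → Set E, (∀ ω, (M ω).Nonempty) ∧ (∀ ω, IsClosed (M ω)) ∧ SetValuedMeasurable m M ∧
      lpSelections m p μ M = D := by
  let x := TopologicalSpace.denseSeq E
  have hx : DenseRange x := TopologicalSpace.denseRange_denseSeq E
  have hint : ∀ (f : Lp E p μ) (i : ℕ), Integrable (fun ω => ‖f ω - x i‖) μ := fun f i =>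
    (((Lp.memLp f).integrable Fact.out).sub (integrable_const _)).norm
  let I : ℕ → Lp E p μ → ℝ := fun i f => ∫ ω, ‖f ω - x i‖ ∂μ
  -- The map is generated by near-minimisers in `D` of the L^1 distance to each constant `x i`, with
  -- tolerances 1/(j+1).
  have hmin : ∀ q : ℕ, ∃ g ∈ D, ∀ h ∈ D, I q.unpair.1 g ≤ I q.unpair.1 h + 1 / (q.unpair.2 + 1) := by
    intro q
    have hbdd : BddBelow (I q.unpair.1 '' D) :=
      ⟨0, by rintro _ ⟨f, -, rfl⟩; exact integral_nonneg fun _ => norm_nonneg _⟩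
    obtain ⟨_, ⟨g, hg, rfl⟩, hlt⟩ := exists_lt_of_csInf_lt (hne.image (I q.unpair.1))
      (lt_add_of_pos_right (sInf (I q.unpair.1 '' D))
        (show (0 : ℝ) < 1 / (q.unpair.2 + 1) by positivity))
    refine ⟨g, hg, fun h hh => hlt.le.trans ?_⟩
    gcongr
    exact csInf_le hbdd ⟨h, hh, rfl⟩
  choose g hgD hgmin using hmin
  choose g' hg' hgg' using fun n => hmeas _ (hgD n)
  refine ⟨fun ω => _root_.closure (range fun n => g' n ω),
    fun ω => (range_nonempty _).closure, fun ω => isClosed_closure, fun O hO => ?_, ?_⟩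
  · have : {ω | (_root_.closure (range fun n => g' n ω) ∩ O).Nonempty} = ⋃ n, g' n ⁻¹' O := by
      ext ω
      rw [mem_ofPred_eq, closure_inter_open_nonempty_iff hO]
      simp [Set.Nonempty]
    rw [this]
    borelize E
    exact MeasurableSet.iUnion fun n => (hg' n).measurable hO.measurableSet
  refine Subset.antisymm ?_ fun f hf => ⟨hmeas f hf, ?_⟩
  · rintro f ⟨hfm, hf⟩
    rw [← hcl.closure_eq]
    refine hD.mem_closure_of_ae_mem_closure_range hp hm hgD (fun n => ⟨g' n, hg' n, hgg' n⟩) hfm ?_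
    filter_upwards [hf, ae_all_iff.2 hgg'] with ω h1 h2
    simpa only [h2] using h1
  · obtain ⟨f', hf', hff'⟩ := hmeas f hf
    let B : ℕ → ℕ → Set Ω := fun i k => {ω | dist (f' ω) (x i) < 1 / (k + 1)} ∩
      ⋂ n, {ω | 3 * (1 / ((k : ℝ) + 1)) ≤ dist (f' ω) (g' n ω)}
    have hB : ∀ i k, MeasurableSet[m] (B i k) := fun i k =>
      ((hf'.dist stronglyMeasurable_const).measurable measurableSet_Iio).inter
        (MeasurableSet.iInter fun n => (hf'.dist (hg' n)).measurable measurableSet_Ici)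
    have hB0 : ∀ i k, μ (B i k) = 0 := by
      intro i k
      have hδ : (0 : ℝ) < 1 / (k + 1) := by positivity
      -- With δ = 1/(k+1), on `B i k` the function `f` is within δ of `x i` while each `g n` is at
      -- least 2δ away. Gluing `f` into a near-minimiser there gains at least δ times the measure of
      -- `B i k`, which cannot exceed the tolerance.
      have hle : ∀ j : ℕ, 1 / ((k : ℝ) + 1) * μ.real (B i k) ≤ 1 / (j + 1) := by
        intro j
        obtain ⟨h, h1, h2⟩ := exists_Lp_glue (hm _ (hB i k)) f (g (Nat.pair i j))
        have h3 := hgmin (Nat.pair i j) h (hD _ (hB i k) f hf _ (hgD _) h h1 h2)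
        rw [Nat.unpair_pair] at h3
        have h4 : I i h ≤ I i (g (Nat.pair i j)) - 1 / ((k : ℝ) + 1) * μ.real (B i k) := by
          have h5 : ∫ ω, (B i k).indicator (fun _ => 1 / ((k : ℝ) + 1)) ω ∂μ =
              1 / ((k : ℝ) + 1) * μ.real (B i k) := by
            rw [integral_indicator_const _ (hm _ (hB i k)), smul_eq_mul, mul_comm]
          have h6 : Integrable ((B i k).indicator fun _ => 1 / ((k : ℝ) + 1)) μ :=
            (integrable_const _).indicator (hm _ (hB i k))
          rw [← h5, ← integral_sub (hint _ i) h6]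
          refine integral_mono_ae (hint h i) ((hint _ i).sub h6) ?_
          filter_upwards [h1, h2, hff', hgg' (Nat.pair i j)] with ω h7 h8 h9 h10
          by_cases hω : ω ∈ B i k
          · simp only [indicator_of_mem hω, h7 hω, h9, h10]
            have h11 : dist (f' ω) (x i) < 1 / (k + 1) := hω.1
            have h12 : 3 * (1 / ((k : ℝ) + 1)) ≤ dist (f' ω) (g' (Nat.pair i j) ω) :=
              mem_iInter.1 hω.2 (Nat.pair i j)
            have h13 := dist_triangle_right (f' ω) (g' (Nat.pair i j) ω) (x i)
            rw [← dist_eq_norm, ← dist_eq_norm]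
            linarith
          · simp only [indicator_of_notMem hω, h8 hω, sub_zero, le_refl]
        dsimp only at h3
        linarith
      have hle0 : 1 / ((k : ℝ) + 1) * μ.real (B i k) ≤ 0 :=
        ge_of_tendsto' tendsto_one_div_add_atTop_nhds_zero_nat hle
      have h0 : μ.real (B i k) = 0 := by
        refine le_antisymm ?_ measureReal_nonneg
        by_contra! hpos
        have := mul_pos hδ hpos
        linarith
      exact (measureReal_eq_zero_iff).1 h0
    have hae : ∀ᵐ ω ∂μ, ∀ i k, ω ∉ B i k :=
      ae_all_iff.2 fun i => ae_all_iff.2 fun k => measure_eq_zero_iff_ae_notMem.1 (hB0 i k)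
    filter_upwards [hae, hff'] with ω h1 h2
    rw [h2]
    refine Metric.mem_closure_range_iff.2 fun ε hε => ?_
    by_contra! hfar
    obtain ⟨k, hk⟩ := exists_nat_one_div_lt (show 0 < ε / 3 by positivity)
    obtain ⟨i, hi⟩ := hx.exists_dist_lt (f' ω) (show (0 : ℝ) < 1 / (k + 1) by positivity)
    exact h1 i k ⟨hi, mem_iInter.2 fun n => (by linarith : _ ≤ ε).trans (hfar n)⟩

theorem IsDecomposable.mono {D : Set (Lp E p μ)} (hm : m ≤ mΩ) (hD : IsDecomposable mΩ D) :
    IsDecomposable m D := fun A hA => hD A (hm _ hA)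

theorem exists_seq_tendsto_ae_of_mem_closure [Fact (1 ≤ p)] {D : Set (Lp E p μ)} {f : Lp E p μ}
    (hf : f ∈ closure D) : ∃ g : ℕ → Lp E p μ, (∀ n, g n ∈ D) ∧
      ∀ᵐ ω ∂μ, Tendsto (fun n => g n ω) atTop (𝓝 (f ω)) := by
  obtain ⟨g, hgD, hg⟩ := mem_closure_iff_seq_limit.1 hf
  obtain ⟨ns, -, hns⟩ := (tendstoInMeasure_of_tendsto_Lp hg).exists_seq_tendsto_ae
  exact ⟨fun n => g (ns n), fun n => hgD _, hns⟩

theorem convex_lpSelections [NormedSpace ℝ E] {G : Ω → Set E}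
    (hG : ∀ᵐ ω ∂μ, Convex ℝ (G ω)) :
    Convex ℝ (lpSelections m p μ G) := by
  rintro f ⟨hf, hfG⟩ g ⟨hg, hgG⟩ a b ha hb hab
  have heq : (a • f + b • g : Lp E p μ) =ᵐ[μ] a • ⇑f + b • ⇑g := by
    filter_upwards [Lp.coeFn_add (a • f) (b • g), Lp.coeFn_smul a f, Lp.coeFn_smul b g] with
      ω h1 h2 h3
    rw [h1, Pi.add_apply, h2, h3, Pi.add_apply]
  refine ⟨((hf.const_smul a).add (hg.const_smul b)).congr heq.symm, ?_⟩
  filter_upwards [heq, hG, hfG, hgG] with ω h1 h2 h3 h4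
  rw [h1]
  exact h2 h3 h4 ha hb hab

/-- A measurable map with closed values whose `L^p` selections form a convex set has almost surely
convex values. -/
theorem ae_convex_of_convex_lpSelections [NormedSpace ℝ E] [CompleteSpace E]
    [TopologicalSpace.SeparableSpace E] [IsFiniteMeasure μ] (hm : m ≤ mΩ)
    {M : Ω → Set E} (hM : SetValuedMeasurable m M) (hne : ∀ ω, (M ω).Nonempty)
    (hcl : ∀ ω, IsClosed (M ω)) (hS : (lpSelections m p μ M).Nonempty)
    (hconv : Convex ℝ (lpSelections m p μ M)) : ∀ᵐ ω ∂μ, Convex ℝ (M ω) := by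
  obtain ⟨g, hg, hgM⟩ := exists_lpSelections_dense hm hM hne hcl hS
  let t : ℕ → Icc (0 : ℝ) 1 := TopologicalSpace.denseSeq _
  have ht : DenseRange t := TopologicalSpace.denseRange_denseSeq _
  have hcomb : ∀ j k n, ∀ᵐ ω ∂μ, (1 - (t n : ℝ)) • g j ω + (t n : ℝ) • g k ω ∈ M ω := by
    intro j k n
    have h1 := hconv (hg j) (hg k) (sub_nonneg.2 (t n).2.2) (t n).2.1 (by ring)
    filter_upwards [h1.2, Lp.coeFn_add ((1 - (t n : ℝ)) • g j) ((t n : ℝ) • g k),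
      Lp.coeFn_smul (1 - (t n : ℝ)) (g j), Lp.coeFn_smul (t n : ℝ) (g k)] with ω h2 h3 h4 h5
    rwa [h3, Pi.add_apply, h4, h5] at h2
  filter_upwards [hgM, ae_all_iff.2 fun j => ae_all_iff.2 fun k => ae_all_iff.2 (hcomb j k)] with
    ω hω hωc
  -- Only countably many combinations are controlled almost surely; limits are taken first in the
  -- points, then in the coefficient.
  have hn : ∀ n, ∀ y ∈ M ω, ∀ z ∈ M ω, (1 - (t n : ℝ)) • y + (t n : ℝ) • z ∈ M ω := by
    intro n y hy z hz
    have hc : Continuous (Function.uncurry fun y z : E => (1 - (t n : ℝ)) • y + (t n : ℝ) • z) := by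
      unfold Function.uncurry
      fun_prop
    have := map_mem_closure₂ (u := M ω) hc (hω ▸ hy) (hω ▸ hz) (by
      rintro _ ⟨j, rfl⟩ _ ⟨k, rfl⟩
      exact hωc j k n)
    rwa [(hcl ω).closure_eq] at this
  have hs : ∀ s : Icc (0 : ℝ) 1, ∀ y ∈ M ω, ∀ z ∈ M ω, (1 - (s : ℝ)) • y + (s : ℝ) • z ∈ M ω := by
    intro s y hy z hz
    have hclosed : IsClosed {s : Icc (0 : ℝ) 1 | (1 - (s : ℝ)) • y + (s : ℝ) • z ∈ M ω} :=
      (hcl ω).preimage (by fun_prop)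
    exact closure_minimal (by rintro _ ⟨n, rfl⟩; exact hn n y hy z hz) hclosed (ht s)
  intro y hy z hz a b ha hb hab
  have := hs ⟨b, hb, by linarith⟩ y hy z hz
  rwa [show a = 1 - b by linarith]

theorem lpSelections_add_subset {F G : Ω → Set E} :
    lpSelections m p μ F + lpSelections m p μ G ⊆ lpSelections m p μ fun ω => F ω + G ω := by
  rintro _ ⟨f, ⟨hf, hfF⟩, g, ⟨hg, hgG⟩, rfl⟩
  refine ⟨(hf.add hg).congr (Lp.coeFn_add f g).symm, ?_⟩
  filter_upwards [hfF, hgG, Lp.coeFn_add f g] with ω h1 h2 h3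
  rw [h3]
  exact add_mem_add h1 h2

/-- Up to closure, the selections of a Minkowski sum are the sums of selections. -/
theorem lpSelections_add_subset_closure [CompleteSpace E]
    [TopologicalSpace.SeparableSpace E] [Fact (1 ≤ p)] [IsProbabilityMeasure μ] (hp : p ≠ ∞)
    (hm : m ≤ mΩ) {F G : Ω → Set E}
    (hF : SetValuedMeasurable m F) (hFne : ∀ ω, (F ω).Nonempty) (hFcl : ∀ ω, IsClosed (F ω))
    (hFS : (lpSelections m p μ F).Nonempty)
    (hG : SetValuedMeasurable m G) (hGne : ∀ ω, (G ω).Nonempty) (hGcl : ∀ ω, IsClosed (G ω))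
    (hGS : (lpSelections m p μ G).Nonempty) :
    lpSelections m p μ (fun ω => F ω + G ω) ⊆
      closure (lpSelections m p μ F + lpSelections m p μ G) := by
  obtain ⟨a, ha, haF⟩ := exists_lpSelections_dense hm hF hFne hFcl hFS
  obtain ⟨b, hb, hbG⟩ := exists_lpSelections_dense hm hG hGne hGcl hGS
  rintro f ⟨hf, hfFG⟩
  refine ((isDecomposable_lpSelections F).add hm
    (isDecomposable_lpSelections G)).mem_closure_of_ae_mem_closure_range hp hm
    (g := fun n => a n.unpair.1 + b n.unpair.2) (fun n => add_mem_add (ha _) (hb _))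
    (fun n => ((ha _).1.add (hb _).1).congr (Lp.coeFn_add _ _).symm) hf ?_
  filter_upwards [haF, hbG, hfFG,
    ae_all_iff.2 fun n : ℕ => Lp.coeFn_add (a n.unpair.1) (b n.unpair.2)] with ω h1 h2 h3 h4
  obtain ⟨y, hy, z, hz, hyz⟩ := h3
  rw [h1] at hy
  rw [h2] at hz
  rw [← hyz]
  refine map_mem_closure₂ continuous_add hy hz ?_
  rintro _ ⟨j, rfl⟩ _ ⟨k, rfl⟩
  refine ⟨Nat.pair j k, ?_⟩
  simpa using h4 (Nat.pair j k)

/-- Write x = (b + x) - b with `b` in `G ω`; then `b + x` lies in `F ω`. -/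
theorem IntegrablyBounded.of_add_eq {F G H : Ω → Set E} (hF : IntegrablyBounded p μ F)
    (hG : IntegrablyBounded p μ G) (hGne : ∀ ω, (G ω).Nonempty) (h : ∀ ω, G ω + H ω = F ω) :
    IntegrablyBounded p μ H := by
  obtain ⟨v, hv, hvF⟩ := hF
  obtain ⟨w, hw, hwG⟩ := hG
  refine ⟨fun ω => |v ω| + |w ω|, hv.abs.add hw.abs, ?_⟩
  filter_upwards [hvF, hwG] with ω h1 h2
  refine iSup₂_le fun x hx => ?_
  obtain ⟨b, hb⟩ := hGne ω
  have h3 : ‖b + x‖ₑ ≤ ENNReal.ofReal (v ω) :=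
    (le_iSup₂ (f := fun x (_ : x ∈ F ω) => ‖x‖ₑ) _ (h ω ▸ add_mem_add hb hx)).trans h1
  have h4 : ‖b‖ₑ ≤ ENNReal.ofReal (w ω) :=
    (le_iSup₂ (f := fun x (_ : x ∈ G ω) => ‖x‖ₑ) _ hb).trans h2
  rw [ENNReal.ofReal_add (abs_nonneg _) (abs_nonneg _)]
  calc ‖x‖ₑ = ‖(b + x) - b‖ₑ := by simp
    _ ≤ ‖b + x‖ₑ + ‖b‖ₑ := enorm_sub_le
    _ ≤ _ := add_le_add (h3.trans (ENNReal.ofReal_le_ofReal (le_abs_self _)))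
      (h4.trans (ENNReal.ofReal_le_ofReal (le_abs_self _)))

end Decomposable

/-! ### Set-valued conditional expectation: existence, values, additivity -/

section ConditionalExpectation

open Filter Topology

variable {Ω E : Type*} [NormedAddCommGroup E] [NormedSpace ℝ E] [CompleteSpace E]
  {m mΩ : MeasurableSpace Ω} {p : ℝ≥0∞} [Fact (1 ≤ p)] {μ : Measure Ω} [IsProbabilityMeasure μ]

/-- The conditional expectation as a contraction of `L^p`. -/
noncomputable def condExpLp (m : MeasurableSpace Ω) {mΩ : MeasurableSpace Ω} (p : ℝ≥0∞)
    [Fact (1 ≤ p)] (μ : Measure Ω) [IsProbabilityMeasure μ] : Lp E p μ →L[ℝ] Lp E p μ :=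
  LinearMap.mkContinuous
    { toFun := fun f => ((Lp.memLp f).condExp (m := m) Fact.out).toLp
      map_add' := fun f g => by
        rw [← MemLp.toLp_add]
        refine MemLp.toLp_congr _ _ ?_
        exact (condExp_congr_ae (Lp.coeFn_add f g)).trans
          (condExp_add ((Lp.memLp f).integrable Fact.out) ((Lp.memLp g).integrable Fact.out) m)
      map_smul' := fun c f => by
        rw [RingHom.id_apply, ← MemLp.toLp_const_smul]
        refine MemLp.toLp_congr _ _ ?_
        exact (condExp_congr_ae (Lp.coeFn_smul c f)).trans (condExp_smul c _ m) } 1 fun f => by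
    rw [one_mul, LinearMap.coe_mk, AddHom.coe_mk, Lp.norm_toLp, Lp.norm_def]
    exact ENNReal.toReal_mono (Lp.eLpNorm_ne_top f) (eLpNorm_condExp_le_eLpNorm _ Fact.out)

theorem coeFn_condExpLp (f : Lp E p μ) : condExpLp m p μ f =ᵐ[μ] μ[f | m] :=
  ((Lp.memLp f).condExp (m := m) Fact.out).coeFn_toLp

theorem setOf_ae_eq_condExp (S : Set (Lp E p μ)) :
    {f : Lp E p μ | ∃ g ∈ S, f =ᵐ[μ] μ[g | m]} = condExpLp m p μ '' S := by
  ext f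
  constructor
  · rintro ⟨g, hg, hfg⟩
    exact ⟨g, hg, Lp.ext ((coeFn_condExpLp g).trans hfg.symm)⟩
  · rintro ⟨g, hg, rfl⟩
    exact ⟨g, hg, coeFn_condExpLp g⟩

theorem aestronglyMeasurable_condExpLp (f : Lp E p μ) :
    AEStronglyMeasurable[m] (condExpLp m p μ f) μ :=
  ⟨_, stronglyMeasurable_condExp, coeFn_condExpLp f⟩

/-- Indicators of sets of `m` pull out of the conditional expectation; this locality is what
preserves decomposability. -/
theorem condExpLp_ae_eq_on {A : Set Ω} (hA : MeasurableSet[m] A) {f g : Lp E p μ}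
    (h : ∀ᵐ ω ∂μ, ω ∈ A → f ω = g ω) :
    ∀ᵐ ω ∂μ, ω ∈ A → condExpLp m p μ f ω = condExpLp m p μ g ω := by
  have h1 : A.indicator f =ᵐ[μ] A.indicator g := by
    filter_upwards [h] with ω hω
    by_cases hωA : ω ∈ A
    · simp [hωA, hω hωA]
    · simp [hωA]
  filter_upwards [condExp_congr_ae (m := m) h1,
    condExp_indicator ((Lp.memLp f).integrable Fact.out) hA,
    condExp_indicator ((Lp.memLp g).integrable Fact.out) hA, coeFn_condExpLp (m := m) f,
    coeFn_condExpLp (m := m) g] with ω h2 h3 h4 h5 h6 hω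
  rw [h3, h4, indicator_of_mem hω, indicator_of_mem hω] at h2
  rw [h5, h6, h2]

theorem IsDecomposable.image_condExpLp (hm : m ≤ mΩ) {D : Set (Lp E p μ)}
    (hD : IsDecomposable m D) : IsDecomposable m (condExpLp m p μ '' D) := by
  rintro A hA _ ⟨f, hf, rfl⟩ _ ⟨g, hg, rfl⟩ h h1 h2
  obtain ⟨k, hk1, hk2⟩ := exists_Lp_glue (hm _ hA) f g
  refine ⟨k, hD A hA f hf g hg k hk1 hk2, Lp.ext ?_⟩
  filter_upwards [h1, h2, condExpLp_ae_eq_on hA hk1,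
    condExpLp_ae_eq_on hA.compl hk2] with ω h3 h4 h5 h6
  by_cases hω : ω ∈ A
  · rw [h3 hω, h5 hω]
  · rw [h4 hω, h6 hω]

theorem exists_isSetCondExp [TopologicalSpace.SeparableSpace E] (hp : p ≠ ∞) (hm : m ≤ mΩ)
    {G : Ω → Set E} (hG : (lpSelections mΩ p μ G).Nonempty) :
    ∃ M, IsSetCondExp m p μ G M := by
  have hdec : IsDecomposable m (closure (condExpLp m p μ '' lpSelections mΩ p μ G)) :=
    (((isDecomposable_lpSelections G).mono hm).image_condExpLp hm).closure hm
  obtain ⟨M, h1, h2, h3, h4⟩ := hdec.exists_lpSelections_eq hp hm isClosed_closure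
    (hG.image _).closure (closure_minimal (by
      rintro _ ⟨f, -, rfl⟩
      exact aestronglyMeasurable_condExpLp f) (isClosed_aestronglyMeasurable hm))
  exact ⟨M, h1, h2, h3, by rw [h4, setOf_ae_eq_condExp]⟩

namespace IsSetCondExp

variable {G M : Ω → Set E}

theorem lpSelections_eq (h : IsSetCondExp m p μ G M) :
    lpSelections m p μ M = closure (condExpLp m p μ '' lpSelections mΩ p μ G) := by
  rw [h.selections_eq, setOf_ae_eq_condExp]

theorem lpSelections_nonempty (h : IsSetCondExp m p μ G M)
    (hG : (lpSelections mΩ p μ G).Nonempty) : (lpSelections m p μ M).Nonempty := by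
  rw [h.lpSelections_eq]
  exact (hG.image _).closure

theorem ae_convex [TopologicalSpace.SeparableSpace E] (hm : m ≤ mΩ) (h : IsSetCondExp m p μ G M)
    (hG : (lpSelections mΩ p μ G).Nonempty) (hconv : ∀ ω, Convex ℝ (G ω)) :
    ∀ᵐ ω ∂μ, Convex ℝ (M ω) := by
  refine ae_convex_of_convex_lpSelections hm h.measurable h.nonempty h.isClosed
    (h.lpSelections_nonempty hG) ?_
  rw [h.lpSelections_eq]
  exact ((convex_lpSelections (ae_of_all _ hconv)).linear_image
    (condExpLp m p μ).toLinearMap).closure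

/-- Each conditioned selection is bounded by E(|v|) given `m`, by the norm inequality and
monotonicity. The bound survives almost sure limits, and a countable dense family of selections
carries it to the values. -/
theorem ae_isBounded [TopologicalSpace.SeparableSpace E] (hm : m ≤ mΩ)
    (h : IsSetCondExp m p μ G M) (hG : (lpSelections mΩ p μ G).Nonempty)
    (hb : IntegrablyBounded p μ G) : ∀ᵐ ω ∂μ, Bornology.IsBounded (M ω) := by
  obtain ⟨v, hv, hvG⟩ := hb
  have hbound : ∀ f ∈ lpSelections m p μ M, ∀ᵐ ω ∂μ, ‖f ω‖ ≤ μ[fun ω => |v ω| | m] ω := by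
    intro f hf
    rw [h.lpSelections_eq] at hf
    obtain ⟨u, huS, hu⟩ := exists_seq_tendsto_ae_of_mem_closure hf
    have hun : ∀ n, ∀ᵐ ω ∂μ, ‖u n ω‖ ≤ μ[fun ω => |v ω| | m] ω := by
      intro n
      obtain ⟨g, ⟨-, hgG⟩, hgu⟩ := huS n
      have hle : (fun ω => ‖g ω‖) ≤ᵐ[μ] fun ω => |v ω| := by
        filter_upwards [hgG, hvG] with ω h1 h2
        have h3 : ‖g ω‖ₑ ≤ ENNReal.ofReal (v ω) :=
          (le_iSup₂ (f := fun x (_ : x ∈ G ω) => ‖x‖ₑ) _ h1).trans h2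
        rw [← ofReal_norm] at h3
        exact (ENNReal.ofReal_le_ofReal_iff (abs_nonneg _)).1
          (h3.trans (ENNReal.ofReal_le_ofReal (le_abs_self _)))
      filter_upwards [coeFn_condExpLp (m := m) g, norm_condExp_le (m := m) (μ := μ) g,
        condExp_mono (m := m) ((Lp.memLp g).integrable Fact.out).norm
          (hv.integrable Fact.out).abs hle] with ω h1 h2 h3
      rw [← hgu, h1]
      exact h2.trans h3
    filter_upwards [hu, ae_all_iff.2 hun] with ω h1 h2
    exact le_of_tendsto' h1.norm h2
  obtain ⟨g, hg, hgM⟩ := exists_lpSelections_dense hm h.measurable h.nonempty h.isClosed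
    (h.lpSelections_nonempty hG)
  filter_upwards [hgM, ae_all_iff.2 fun n => hbound _ (hg n)] with ω h1 h2
  rw [h1]
  refine Bornology.IsBounded.closure (isBounded_iff_forall_norm_le.2
    ⟨μ[fun ω => |v ω| | m] ω, ?_⟩)
  rintro _ ⟨n, rfl⟩
  exact h2 n

theorem ae_mem_convexWeaklyCompacts [TopologicalSpace.SeparableSpace E]
    (hE : Function.Surjective (NormedSpace.inclusionInDoubleDual ℝ E)) (hm : m ≤ mΩ)
    (h : IsSetCondExp m p μ G M) (hG : (lpSelections mΩ p μ G).Nonempty)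
    (hconv : ∀ ω, Convex ℝ (G ω)) (hb : IntegrablyBounded p μ G) :
    ∀ᵐ ω ∂μ, M ω ∈ convexWeaklyCompacts E := by
  filter_upwards [h.ae_convex hm hG hconv, h.ae_isBounded hm hG hb] with ω h1 h2
  exact mem_convexWeaklyCompacts_of_reflexive hE (h.nonempty ω) h1 (h.isClosed ω) h2

end IsSetCondExp

/-- Set-valued conditional expectations are additive. -/
theorem IsSetCondExp.ae_add_eq [TopologicalSpace.SeparableSpace E] (hp : p ≠ ∞) (hm : m ≤ mΩ)
    {F G M N K : Ω → Set E}
    (hF : SetValuedMeasurable mΩ F) (hFne : ∀ ω, (F ω).Nonempty) (hFcl : ∀ ω, IsClosed (F ω))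
    (hFS : (lpSelections mΩ p μ F).Nonempty)
    (hG : SetValuedMeasurable mΩ G) (hGne : ∀ ω, (G ω).Nonempty) (hGcl : ∀ ω, IsClosed (G ω))
    (hGS : (lpSelections mΩ p μ G).Nonempty)
    (hM : IsSetCondExp m p μ F M) (hN : IsSetCondExp m p μ G N)
    (hK : IsSetCondExp m p μ (fun ω => F ω + G ω) K) (hcl : ∀ᵐ ω ∂μ, IsClosed (M ω + N ω)) :
    ∀ᵐ ω ∂μ, M ω + N ω = K ω := by
  -- Conditioning is linear and continuous, so it carries density of sums of selections of `F` and
  -- `G` over to `M` and `N`.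
  have hKS : lpSelections m p μ K =
      closure (lpSelections m p μ M + lpSelections m p μ N) := by
    rw [hK.lpSelections_eq, hM.lpSelections_eq, hN.lpSelections_eq]
    refine Subset.antisymm (closure_minimal ?_ isClosed_closure)
      (closure_minimal ?_ isClosed_closure)
    · refine (image_mono (lpSelections_add_subset_closure hp le_rfl hF hFne hFcl hFS hG hGne hGcl
        hGS)).trans ((image_closure_subset_closure_image (condExpLp m p μ).continuous).trans ?_)
      rw [image_add]
      exact closure_mono (add_subset_add subset_closure subset_closure)
    · rintro _ ⟨f, hf, g, hg, rfl⟩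
      refine map_mem_closure₂ continuous_add hf hg ?_
      rintro _ ⟨f, hf, rfl⟩ _ ⟨g, hg, rfl⟩
      exact ⟨f + g, lpSelections_add_subset (add_mem_add hf hg), map_add _ _ _⟩
  have hMS := hM.lpSelections_nonempty hFS
  have hNS := hN.lpSelections_nonempty hGS
  obtain ⟨a, ha, haM⟩ := exists_lpSelections_dense hm hM.measurable hM.nonempty hM.isClosed hMS
  obtain ⟨b, hb, hbN⟩ := exists_lpSelections_dense hm hN.measurable hN.nonempty hN.isClosed hNS
  obtain ⟨c, hc, hcK⟩ := exists_lpSelections_dense hm hK.measurable hK.nonempty hK.isClosed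
    (hKS ▸ (hMS.add hNS).closure)
  have h1 : ∀ j k, ∀ᵐ ω ∂μ, a j ω + b k ω ∈ K ω := by
    intro j k
    have : a j + b k ∈ lpSelections m p μ K :=
      hKS ▸ subset_closure (add_mem_add (ha j) (hb k))
    filter_upwards [this.2, Lp.coeFn_add (a j) (b k)] with ω h2 h3
    rwa [h3] at h2
  -- Elements of the closure are almost sure limits of sums along a sequence; here closedness of `M
  -- ω + N ω` is indispensable.
  have h2 : ∀ n, ∀ᵐ ω ∂μ, c n ω ∈ M ω + N ω := by
    intro n
    obtain ⟨u, huS, hu⟩ := exists_seq_tendsto_ae_of_mem_closure (hKS ▸ hc n)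
    have hun : ∀ i, ∀ᵐ ω ∂μ, u i ω ∈ M ω + N ω := fun i =>
      (lpSelections_add_subset (huS i)).2
    filter_upwards [hu, ae_all_iff.2 hun, hcl] with ω h3 h4 h5
    exact h5.mem_of_tendsto h3 (Eventually.of_forall h4)
  filter_upwards [haM, hbN, hcK, ae_all_iff.2 fun j => ae_all_iff.2 (h1 j), ae_all_iff.2 h2, hcl]
    with ω h3 h4 h5 h6 h7 h8
  refine Subset.antisymm ?_ ?_
  · rintro _ ⟨y, hy, z, hz, rfl⟩
    have := map_mem_closure₂ (u := K ω) continuous_add (h3 ▸ hy) (h4 ▸ hz) (by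
      rintro _ ⟨j, rfl⟩ _ ⟨k, rfl⟩
      exact h6 j k)
    rwa [(hK.isClosed ω).closure_eq] at this
  · rw [h5]
    exact closure_minimal (range_subset_iff.2 h7) h8

end ConditionalExpectation

/-! ### The main theorem -/

theorem lemma5p5 {E : Type*} [NormedAddCommGroup E] [NormedSpace ℝ E] [CompleteSpace E]
    [TopologicalSpace.SeparableSpace E]
    (hE : Function.Surjective (NormedSpace.inclusionInDoubleDual ℝ E))
    {Ω : Type*} {mΩ : MeasurableSpace Ω} (μ : Measure Ω) [IsProbabilityMeasure μ]
    (T : ℝ) (hT : 0 < T) (𝓕 : Filtration (Set.Icc (0 : ℝ) T) mΩ)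
    (h𝓕 : 𝓕 ⟨T, hT.le, le_rfl⟩ = mΩ)
    (p : ℝ≥0∞) [Fact (1 ≤ p)] (hp : 1 < p) (hp' : p ≠ ∞)
    (Φ₁ Φ₂ Ψ : Ω → Set E)
    (hΦ₁ : ∀ ω, Φ₁ ω ∈ convexWeaklyCompacts E) (hΦ₂ : ∀ ω, Φ₂ ω ∈ convexWeaklyCompacts E)
    (hm₁ : SetValuedMeasurable (𝓕 ⟨T, hT.le, le_rfl⟩) Φ₁)
    (hm₂ : SetValuedMeasurable (𝓕 ⟨T, hT.le, le_rfl⟩) Φ₂)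
    (hΨ : ∀ ω, IsHukuharaDiff (Φ₁ ω) (Φ₂ ω) (Ψ ω)) :
    SetValuedMeasurable (𝓕 ⟨T, hT.le, le_rfl⟩) Ψ ∧
    (IntegrablyBounded p μ Φ₁ → IntegrablyBounded p μ Φ₂ →
      IntegrablyBounded p μ Ψ ∧
      ∀ t : Set.Icc (0 : ℝ) T,
        (∃ M₁, IsSetCondExp (𝓕 t) p μ Φ₁ M₁) ∧
        (∃ M₂, IsSetCondExp (𝓕 t) p μ Φ₂ M₂) ∧
        (∃ M, IsSetCondExp (𝓕 t) p μ Ψ M) ∧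
        ∀ M₁ M₂ M : Ω → Set E,
          IsSetCondExp (𝓕 t) p μ Φ₁ M₁ → IsSetCondExp (𝓕 t) p μ Φ₂ M₂ →
          IsSetCondExp (𝓕 t) p μ Ψ M →
          ∀ᵐ ω ∂μ, IsHukuharaDiff (M₁ ω) (M₂ ω) (M ω)) := by
  have hm := hm₁.hukuharaDiff hE hm₂ hΨ
  refine ⟨hm, fun hb₁ hb₂ => ?_⟩
  rw [h𝓕] at hm₁ hm₂ hm
  have hb : IntegrablyBounded p μ Ψ :=
    hb₁.of_add_eq hb₂ (fun ω => (hΦ₂ ω).1) fun ω => (hΨ ω).add_eq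
  have hcl₁ : ∀ ω, IsClosed (Φ₁ ω) := fun ω => isClosed_of_isCompact_toWeakSpace (hΦ₁ ω).2.2
  have hcl₂ : ∀ ω, IsClosed (Φ₂ ω) := fun ω => isClosed_of_isCompact_toWeakSpace (hΦ₂ ω).2.2
  have hS₁ := hb₁.lpSelections_nonempty hm₁ (fun ω => (hΦ₁ ω).1) hcl₁
  have hS₂ := hb₂.lpSelections_nonempty hm₂ (fun ω => (hΦ₂ ω).1) hcl₂
  have hS := hb.lpSelections_nonempty hm (fun ω => (hΨ ω).nonempty) fun ω => (hΨ ω).isClosed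
  refine ⟨hb, fun t => ⟨exists_isSetCondExp hp' (𝓕.le t) hS₁, exists_isSetCondExp hp' (𝓕.le t) hS₂,
    exists_isSetCondExp hp' (𝓕.le t) hS, fun M₁ M₂ M hM₁ hM₂ hM => ?_⟩⟩
  have hc₁ := hM₁.ae_mem_convexWeaklyCompacts hE (𝓕.le t) hS₁ (fun ω => (hΦ₁ ω).2.1) hb₁
  have hc₂ := hM₂.ae_mem_convexWeaklyCompacts hE (𝓕.le t) hS₂ (fun ω => (hΦ₂ ω).2.1) hb₂
  have hc := hM.ae_mem_convexWeaklyCompacts hE (𝓕.le t) hS (fun ω => (hΨ ω).convex) hb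
  -- After this substitution `M₁` is a conditional expectation of the sum, so additivity gives M₂ +
  -- M = M₁ directly.
  obtain rfl : (fun ω => Φ₂ ω + Ψ ω) = Φ₁ := funext fun ω => (hΨ ω).add_eq
  have hadd := IsSetCondExp.ae_add_eq hp' (𝓕.le t) hm₂ (fun ω => (hΦ₂ ω).1) hcl₂ hS₂ hm
    (fun ω => (hΨ ω).nonempty) (fun ω => (hΨ ω).isClosed) hS hM₂ hM hM₁ (by
      filter_upwards [hc₂, hc] with ω h1 h2
      exact isClosed_add_of_mem_convexWeaklyCompacts h1 h2)
  filter_upwards [hc₁, hc₂, hc, hadd] with ω h1 h2 h3 h4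
  exact ⟨h1, h2, h3.1, h3.2.1, hM.isClosed ω, h4⟩
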